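/- Let $S$ be a finite semigroup whose idempotents commute and let $K$ be a field of characteristic $0$. Order the set $E(S)$ of idempotents by $f\le f'\iff ff'=f=f'f$, and let $\mu$ be the Möbius function of this finite poset. Call $u\in S$ regular if it has an inverse, that is, some $t$ with $utu=u$ and $tut=t$; this $t$ is then unique and is written $u^{-1}$. Put $\operatorname{dom}u=uu^{-1}$ and $\operatorname{ran}u=u^{-1}u$, and for $s\in S$ let $s^{\downarrow}$ be the set of regular $u$ with $uu^{-1}s=u$. Let $e\in E(S)$ and let $G=G_e$ be the maximal subgroup of $S$ with identity $e$ (the group of units of $eSe$). Let $D$ be the set of regular $t$ for which some regular $p$ has $\operatorname{dom}p=e$ and $\operatorname{ran}p=\operatorname{dom}t$, and let $E(D)$ be the set of idempotents in $D$. For $f\in E(D)$ choose a regular $p_f$ with $\operatorname{dom}p_f=e$, $\operatorname{ran}p_f=f$, and $p_e=e$. Let $\varphi:G\to GL(W)$ be an irreducible finite-dimensional representation of $G$ over $K$ with character $\chi$, and let $d=\dim_K\operatorname{End}_{KG}(W)$. The representation $\varphi^*$ of $S$ associated to $\chi$ acts on $W^{E(D)}$ by $$\varphi^*(s)=\sum_{t\in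 s^{\downarrow}\cap D}\varphi\bigl(p_{\operatorname{dom}t}\,t\,p_{\operatorname{ran}t}^{-1}\bigr)\,E_{\operatorname{dom}t,\operatorname{ran}t},$$ where the $E_{f,f'}$ are the matrix units. **Theorem.** The representation $\varphi^*$ of $S$ is irreducible. If $\theta$ is the character of a finite-dimensional representation of $S$ over $K$ and $m$ is the multiplicity of $\varphi^*$ as a constituent of that representation (the number of factors isomorphic to $\varphi^*$ in a composition series), then $$md=\sum_{f\in E(S),\ f\le e}(\chi,\theta_f)_G\,\mu(f,e)\quad\text{in }K,$$ where $\theta_f(g)=\theta(fg)$ for $g\in G$ and $(\psi,\alpha)_G=\frac1{|G|}\sum_{g\in G}\psi(g^{-1})\alpha(g)$ for functions $\psi,\alpha:G\to K$. -/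

import Mathlib

namespace ECSemigroup

/-! ### Idempotents and maximal subgroups -/

section Basic

variable {S : Type*} [Semigroup S]

/-- A semigroup in which any two idempotents commute. -/
class CommutingIdempotents (S : Type*) [Semigroup S] : Prop where
  comm : ∀ e f : S, IsIdempotentElem e → IsIdempotentElem f → e * f = f * e

/-- The set `E(S)` of idempotents of a semigroup. -/
@[ext]
structure Idem (S : Type*) [Semigroup S] where
  val : S
  idem : val * val = val

/-- The order on `E(S)`: `e ≤ f` iff `e f = e = f e`. -/
instance : PartialOrder (Idem S) where
  le e f := e.val * f.val = e.val ∧ f.val * e.val = e.val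
  le_refl e := ⟨e.idem, e.idem⟩
  le_trans a b c hab hbc :=
    ⟨by rw [← hab.1, mul_assoc, hbc.1], by rw [← hab.2, ← mul_assoc, hbc.2]⟩
  le_antisymm a b hab hba := Idem.ext (hab.1.symm.trans hba.2)

instance [Finite S] : Finite (Idem S) :=
  Finite.of_injective Idem.val fun _ _ h => Idem.ext h

noncomputable instance [Finite S] : Fintype (Idem S) := Fintype.ofFinite _

noncomputable instance : DecidableEq (Idem S) := Classical.decEq _

noncomputable instance : DecidableLE (Idem S) := Classical.decRel _

noncomputable instance : DecidableLT (Idem S) := Classical.decRel _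

noncomputable instance [Finite S] : LocallyFiniteOrder (Idem S) := Fintype.toLocallyFiniteOrder

/-- The maximal subgroup `G_e` of `S` with identity `e`, i.e. the group of units of the monoid
`eSe`: elements `val` of `eSe` together with their (unique) inverse `inv` in `eSe`. -/
structure MaxSubgroup (e : Idem S) where
  val : S
  inv : S
  left_mul : e.val * val = val
  mul_right : val * e.val = val
  left_mul_inv : e.val * inv = inv
  inv_mul_right : inv * e.val = inv
  val_mul_inv : val * inv = e.val
  inv_mul_val : inv * val = e.val

lemma MaxSubgroup.val_injective (e : Idem S) :
    Function.Injective (MaxSubgroup.val : MaxSubgroup e → S) := by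
  intro g h hgh
  have hi : g.inv = h.inv := by
    rw [← g.inv_mul_right, ← h.val_mul_inv, ← hgh, ← mul_assoc, g.inv_mul_val, h.left_mul_inv]
  cases g
  cases h
  simp_all

instance (e : Idem S) : Group (MaxSubgroup e) where
  mul g h :=
    { val := g.val * h.val
      inv := h.inv * g.inv
      left_mul := by rw [← mul_assoc, g.left_mul]
      mul_right := by rw [mul_assoc, h.mul_right]
      left_mul_inv := by rw [← mul_assoc, h.left_mul_inv]
      inv_mul_right := by rw [mul_assoc, g.inv_mul_right]
      val_mul_inv := by
        rw [mul_assoc, ← mul_assoc h.val, h.val_mul_inv, g.left_mul_inv, g.val_mul_inv]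
      inv_mul_val := by
        rw [mul_assoc, ← mul_assoc g.inv, g.inv_mul_val, h.left_mul, h.inv_mul_val] }
  one := ⟨e.val, e.val, e.idem, e.idem, e.idem, e.idem, e.idem, e.idem⟩
  inv g := ⟨g.inv, g.val, g.left_mul_inv, g.inv_mul_right, g.left_mul, g.mul_right,
    g.inv_mul_val, g.val_mul_inv⟩
  mul_assoc g h k := MaxSubgroup.val_injective e (mul_assoc g.val h.val k.val)
  one_mul g := MaxSubgroup.val_injective e g.left_mul
  mul_one g := MaxSubgroup.val_injective e g.mul_right
  inv_mul_cancel g := MaxSubgroup.val_injective e g.inv_mul_val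

instance [Finite S] (e : Idem S) : Finite (MaxSubgroup e) :=
  Finite.of_injective _ (MaxSubgroup.val_injective e)

noncomputable instance [Finite S] (e : Idem S) : Fintype (MaxSubgroup e) := Fintype.ofFinite _

/-! ### Regular elements and their inverses -/

/-- `s` and `t` are inverses of each other: `sts = s` and `tst = t`. -/
def IsInverse (s t : S) : Prop := s * t * s = s ∧ t * s * t = t

/-- `s` is (von Neumann) regular, i.e. `s ∈ R(S)`. -/
def IsReg (s : S) : Prop := ∃ t, IsInverse s t

open Classical in
/-- The inverse `s⁻¹` of a regular element `s` (it is unique if idempotents commute, see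
`IsInverse.unique`). On elements that are not regular the value has no meaning. -/
noncomputable def pinv (s : S) : S := if h : IsReg s then h.choose else s

/-- `dom s = s s⁻¹`, for `s` regular. -/
noncomputable def dom (s : S) : S := s * pinv s

/-- `ran s = s⁻¹ s`, for `s` regular. -/
noncomputable def ran (s : S) : S := pinv s * s

/-- `s↓ = {u ∈ R(S) | u u⁻¹ s = u}`. -/
def lower (s : S) : Set S := {u | IsReg u ∧ u * pinv u * s = u}

/-- The arrows `f ⟶ f'` of the groupoid of `R(S)`: regular `t` with `dom t = f`, `ran t = f'`. -/
@[ext]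
structure Arrow (f f' : Idem S) where
  val : S
  reg : IsReg val
  dom_eq : dom val = f.val
  ran_eq : ran val = f'.val

lemma isInverse_pinv {s : S} (h : IsReg s) : IsInverse s (pinv s) := by
  unfold pinv
  rw [dif_pos h]
  exact h.choose_spec

lemma IsInverse.symm {s t : S} (h : IsInverse s t) : IsInverse t s := ⟨h.2, h.1⟩

lemma Arrow.left_mul {f f' : Idem S} (a : Arrow f f') : f.val * a.val = a.val := by
  have h := (isInverse_pinv a.reg).1
  rwa [show a.val * pinv a.val = f.val from a.dom_eq] at h

lemma Arrow.mul_right {f f' : Idem S} (a : Arrow f f') : a.val * f'.val = a.val := by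
  have h := (isInverse_pinv a.reg).1
  rwa [mul_assoc, show pinv a.val * a.val = f'.val from a.ran_eq] at h

/-- An arrow `f ⟶ f'` lies in `s↓` iff it equals `f s`. -/
lemma Arrow.mem_lower_iff {f f' : Idem S} (t : Arrow f f') (s : S) :
    t.val ∈ lower s ↔ f.val * s = t.val := by
  change IsReg t.val ∧ dom t.val * s = t.val ↔ _
  rw [t.dom_eq]
  exact and_iff_right t.reg

instance [Finite S] (f f' : Idem S) : Finite (Arrow f f') :=
  Finite.of_injective Arrow.val fun _ _ h => Arrow.ext h

noncomputable instance [Finite S] (s : S) (f f' : Idem S) :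
    Fintype {t : Arrow f f' // t.val ∈ lower s} := Fintype.ofFinite _

/-- The set of idempotents isomorphic to `e`, i.e. the idempotents in the `𝒟`-class of `e`. -/
def IdemClass (e : Idem S) : Type _ := {f : Idem S // Nonempty (Arrow e f)}

instance [Finite S] (e : Idem S) : Finite (IdemClass e) :=
  inferInstanceAs (Finite {f : Idem S // Nonempty (Arrow e f)})

noncomputable instance [Finite S] (e : Idem S) : Fintype (IdemClass e) := Fintype.ofFinite _

noncomputable instance (e : Idem S) : DecidableEq (IdemClass e) := Classical.decEq _

/-- A choice, for every idempotent `f` isomorphic to `e`, of an element `p_f` with `dom p_f = e`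
and `ran p_f = f`, such that `p_e = e`. -/
structure Transversal (e : Idem S) where
  arrow : ∀ f : IdemClass e, Arrow e f.1
  base : ∀ f : IdemClass e, f.1 = e → (arrow f).val = e.val

/-! ### The groupoid operations -/

variable [CommutingIdempotents S]

lemma IsInverse.unique {s t t' : S} (h : IsInverse s t) (h' : IsInverse s t') : t = t' := by
  have idem : ∀ {a b : S}, IsInverse a b → IsIdempotentElem (a * b) := fun {a b} hab => by
    change a * b * (a * b) = a * b
    rw [← mul_assoc, hab.1]
  have hc := CommutingIdempotents.comm (t * s) (t' * s) (idem h.symm) (idem h'.symm)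
  have hd := CommutingIdempotents.comm (s * t) (s * t') (idem h) (idem h')
  calc t = t * (s * t' * s) * t := by rw [h'.1, h.2]
    _ = (t * s) * (t' * s) * t := by simp only [mul_assoc]
    _ = (t' * s) * (t * s * t) := by rw [hc, mul_assoc]
    _ = (t' * s * t') * s * t := by rw [h.2, h'.2]
    _ = t' * ((s * t') * (s * t)) := by simp only [mul_assoc]
    _ = t' * (s * t * s * t') := by rw [← hd]; simp only [mul_assoc]
    _ = t' := by rw [h.1, ← mul_assoc, h'.2]

lemma pinv_eq {s t : S} (h : IsInverse s t) : pinv s = t :=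
  (isInverse_pinv ⟨t, h⟩).unique h

/-- Build an arrow from an element and its inverse. -/
def Arrow.mk' {f f' : Idem S} (t t' : S) (h : IsInverse t t') (hd : t * t' = f.val)
    (hr : t' * t = f'.val) : Arrow f f' :=
  ⟨t, ⟨t', h⟩, by rw [dom, pinv_eq h, hd], by rw [ran, pinv_eq h, hr]⟩

/-- The inverse arrow `t⁻¹`. -/
noncomputable def Arrow.inv {f f' : Idem S} (a : Arrow f f') : Arrow f' f :=
  Arrow.mk' (pinv a.val) a.val (isInverse_pinv a.reg).symm a.ran_eq a.dom_eq

lemma Arrow.mul_inv_val {f f' : Idem S} (a : Arrow f f') : a.val * a.inv.val = f.val := a.dom_eq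

lemma Arrow.inv_mul_val {f f' : Idem S} (a : Arrow f f') : a.inv.val * a.val = f'.val := a.ran_eq

lemma Arrow.comp_aux {f f' f'' : Idem S} (a : Arrow f f') (b : Arrow f' f'') :
    a.val * b.val * (b.inv.val * a.inv.val) = f.val := by
  rw [mul_assoc, ← mul_assoc b.val, b.mul_inv_val, a.inv.left_mul, a.mul_inv_val]

lemma Arrow.comp_aux' {f f' f'' : Idem S} (a : Arrow f f') (b : Arrow f' f'') :
    b.inv.val * a.inv.val * (a.val * b.val) = f''.val := by
  rw [mul_assoc, ← mul_assoc a.inv.val, a.inv_mul_val, b.left_mul, b.inv_mul_val]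

/-- The composite of two arrows is their product in `S`. -/
noncomputable def Arrow.comp {f f' f'' : Idem S} (a : Arrow f f') (b : Arrow f' f'') :
    Arrow f f'' :=
  Arrow.mk' (a.val * b.val) (b.inv.val * a.inv.val)
    ⟨by rw [a.comp_aux b, ← mul_assoc, a.left_mul],
      by rw [a.comp_aux' b, ← mul_assoc, b.inv.left_mul]⟩ (a.comp_aux b) (a.comp_aux' b)

/-- An arrow `e ⟶ e` is an element of the maximal subgroup `G_e`. -/
noncomputable def Arrow.toMaxSubgroup {e : Idem S} (a : Arrow e e) : MaxSubgroup e where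
  val := a.val
  inv := a.inv.val
  left_mul := a.left_mul
  mul_right := a.mul_right
  left_mul_inv := a.inv.left_mul
  inv_mul_right := a.inv.mul_right
  val_mul_inv := a.mul_inv_val
  inv_mul_val := a.inv_mul_val

lemma nonempty_transversal (e : Idem S) : Nonempty (Transversal e) := by
  classical
  have hi : IsInverse e.val e.val := ⟨by rw [e.idem, e.idem], by rw [e.idem, e.idem]⟩
  refine ⟨⟨fun f => if h : f.1 = e then Arrow.mk' e.val e.val hi e.idem (by rw [h]; exact e.idem)
    else f.2.some, fun f h => ?_⟩⟩
  rw [dif_pos h]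
  rfl

/-- The element `p_f t p_{f'}⁻¹` of `G_e`, for `t : f ⟶ f'` in the `𝒟`-class of `e`. -/
noncomputable def Transversal.conj {e : Idem S} (p : Transversal e) {f f' : IdemClass e}
    (t : Arrow f.1 f'.1) : MaxSubgroup e :=
  (((p.arrow f).comp t).comp (p.arrow f').inv).toMaxSubgroup

lemma Transversal.conj_mul {e : Idem S} (p : Transversal e) {f f' f'' : IdemClass e}
    (t : Arrow f.1 f'.1) (u : Arrow f'.1 f''.1) :
    p.conj t * p.conj u = p.conj (t.comp u) := by
  apply MaxSubgroup.val_injective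
  change (p.arrow f).val * t.val * (p.arrow f').inv.val *
      ((p.arrow f').val * u.val * (p.arrow f'').inv.val)
    = (p.arrow f).val * (t.val * u.val) * (p.arrow f'').inv.val
  calc _ = (p.arrow f).val * (t.val * ((p.arrow f').inv.val * (p.arrow f').val) * u.val)
        * (p.arrow f'').inv.val := by simp only [mul_assoc]
    _ = _ := by rw [Arrow.inv_mul_val, Arrow.mul_right]

/-- Arrows in `s↓` and `t↓` compose to an arrow in `(st)↓`. -/
lemma Arrow.comp_mem_lower {f f' f'' : Idem S} {s t : S} (a : Arrow f f') (b : Arrow f' f'')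
    (ha : a.val ∈ lower s) (hb : b.val ∈ lower t) : (a.comp b).val ∈ lower (s * t) := by
  rw [Arrow.mem_lower_iff] at ha hb ⊢
  change f.val * (s * t) = a.val * b.val
  rw [← mul_assoc, ha, ← hb, ← mul_assoc, a.mul_right]

/-- Every arrow in `(st)↓` factors through an arrow in `s↓` and an arrow in `t↓`. -/
lemma Arrow.exists_factor {f f'' : Idem S} {s t : S} (w : Arrow f f'')
    (hw : w.val ∈ lower (s * t)) :
    ∃ (f' : Idem S) (a : Arrow f f') (b : Arrow f' f''), a.val ∈ lower s ∧ b.val ∈ lower t ∧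
      a.comp b = w := by
  rw [Arrow.mem_lower_iff] at hw
  have hw' : f.val * s * t = w.val := by rw [mul_assoc, hw]
  -- the inverse of `f s` is `t w⁻¹`
  have hr : f.val * s * (t * w.inv.val) = f.val := by
    rw [← mul_assoc, hw', w.mul_inv_val]
  have h1 : IsInverse (f.val * s) (t * w.inv.val) := by
    refine ⟨by rw [hr, ← mul_assoc, f.idem], ?_⟩
    rw [mul_assoc (t * w.inv.val), hr, mul_assoc, w.inv.mul_right]
  let f' : Idem S := ⟨t * w.inv.val * (f.val * s), by
    rw [← mul_assoc (t * w.inv.val * (f.val * s)), h1.2]⟩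
  have hft : f'.val * t = t * f''.val := by
    change t * w.inv.val * (f.val * s) * t = _
    rw [mul_assoc _ _ t, hw', mul_assoc, w.inv_mul_val]
  have h2 : IsInverse (f'.val * t) (w.inv.val * (f.val * s)) := by
    have h3 : w.inv.val * (f.val * s) * (f'.val * t) = f''.val := by
      rw [hft, mul_assoc, ← mul_assoc (f.val * s), hw', w.mul_right, w.inv_mul_val]
    refine ⟨?_, ?_⟩
    · rw [mul_assoc, h3, hft, mul_assoc, f''.idem]
    · rw [h3, ← mul_assoc, w.inv.left_mul]
  have h2d : f'.val * t * (w.inv.val * (f.val * s)) = f'.val := by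
    rw [hft, mul_assoc, ← mul_assoc f''.val, w.inv.left_mul, ← mul_assoc]
  have h2r : w.inv.val * (f.val * s) * (f'.val * t) = f''.val := by
    rw [hft, mul_assoc, ← mul_assoc (f.val * s), hw', w.mul_right, w.inv_mul_val]
  refine ⟨f', Arrow.mk' (f.val * s) (t * w.inv.val) h1 hr rfl,
    Arrow.mk' (f'.val * t) (w.inv.val * (f.val * s)) h2 h2d h2r, ?_, ?_, ?_⟩
  · rw [Arrow.mem_lower_iff]; rfl
  · rw [Arrow.mem_lower_iff]; rfl
  · apply Arrow.ext
    change f.val * s * (f'.val * t) = w.val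
    rw [hft, ← mul_assoc, hw', w.mul_right]

end Basic

/-! ### Representations of semigroups -/

section Rep

variable {S : Type*} [Semigroup S] {K : Type*} [Field K]
variable {V : Type*} [AddCommGroup V] [Module K V] {W : Type*} [AddCommGroup W] [Module K W]

/-- The character `s ↦ tr (ρ s)` of a representation of a semigroup. -/
noncomputable def character (ρ : S →ₙ* Module.End K V) (s : S) : K := LinearMap.trace K V (ρ s)

/-- A representation of a semigroup `S` is regarded as a representation of the monoid obtained
from `S` by adjoining a new identity element, which acts as the identity. This changes neither
the invariant subspaces nor the equivariant maps. -/
noncomputable def toRep (ρ : S →ₙ* Module.End K V) : Representation K (WithOne S) V :=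
  WithOne.lift ρ

/-- A representation of a semigroup is irreducible if it is not the zero map and its space has
exactly two invariant subspaces. -/
def IsIrred (ρ : S →ₙ* Module.End K V) : Prop := (∃ s, ρ s ≠ 0) ∧ (toRep ρ).IsIrreducible

/-- `ψ` has multiplicity `m` as an irreducible constituent of `ρ`: there is a composition series
of `ρ`, from `0` to the whole space, with exactly `m` factors isomorphic to `ψ`. -/
def HasMultiplicity (ρ : S →ₙ* Module.End K V) (ψ : S →ₙ* Module.End K W) (m : ℕ) : Prop :=
  ∃ c : CompositionSeries (Submodule (MonoidAlgebra K (WithOne S)) (toRep ρ).asModule),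
    c.head = ⊥ ∧ c.last = ⊤ ∧
    m = Nat.card {i : Fin c.length //
      Nonempty ((c i.succ ⧸ (c i.castSucc).submoduleOf (c i.succ))
        ≃ₗ[MonoidAlgebra K (WithOne S)] (toRep ψ).asModule)}

lemma exists_hasMultiplicity [FiniteDimensional K V] (ρ : S →ₙ* Module.End K V)
    (ψ : S →ₙ* Module.End K W) : ∃ m, HasMultiplicity ρ ψ m := by
  have : IsNoetherian (MonoidAlgebra K (WithOne S)) (toRep ρ).asModule :=
    isNoetherian_of_tower K inferInstance
  have : IsArtinian (MonoidAlgebra K (WithOne S)) (toRep ρ).asModule :=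
    isArtinian_of_tower K inferInstance
  obtain ⟨c, h0, h1⟩ := exists_compositionSeries_of_isNoetherian_isArtinian
    (MonoidAlgebra K (WithOne S)) (toRep ρ).asModule
  exact ⟨_, c, h0, h1, rfl⟩

/-- The bilinear form `(ψ, α)_G = |G|⁻¹ ∑_g ψ(g⁻¹) α(g)` on functions on a finite group. -/
noncomputable def pairing {G : Type*} [Group G] [Fintype G] (ψ α : G → K) : K :=
  (Fintype.card G : K)⁻¹ * ∑ g : G, ψ g⁻¹ * α g

variable [Finite S] [CommutingIdempotents S]

/-- For a representation `φ` of `G_e`, the matrix of `s`, with rows and columns indexed by the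
idempotents isomorphic to `e` and with entries in `End W`, that is given by
`∑ φ(p_{dom t} t p_{ran t}⁻¹) E_{dom t, ran t}`, the sum being over all `t ∈ s↓` in the
`𝒟`-class of `e`. In other words, the image of `s` under `KS → KR(S)`, `s ↦ ∑_{t ∈ s↓} ⌊t⌋`,
followed by the projection of `KR(S)` on the summand of this `𝒟`-class, the isomorphism
`⌊t⌋ ↦ p_{dom t} t p_{ran t}⁻¹ E_{dom t, ran t}` of that summand with a matrix algebra over
`K G_e`, and `φ` applied to the entries. -/
noncomputable def starMatrix {e : Idem S} (p : Transversal e)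
    (φ : Representation K (MaxSubgroup e) W) (s : S) :
    Matrix (IdemClass e) (IdemClass e) (Module.End K W) :=
  Matrix.of fun f f' => ∑ t : {t : Arrow f.1 f'.1 // t.val ∈ lower s}, φ (p.conj t.1)

lemma starMatrix_mul {e : Idem S} (p : Transversal e)
    (φ : Representation K (MaxSubgroup e) W) (s t : S) :
    starMatrix p φ (s * t) = starMatrix p φ s * starMatrix p φ t := by
  ext1 f f''
  simp only [starMatrix, Matrix.mul_apply, Matrix.of_apply, Finset.sum_mul_sum,
    ← map_mul, Transversal.conj_mul]
  simp only [← Fintype.sum_prod_type', ← Fintype.sum_sigma']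
  symm
  refine Fintype.sum_bijective
    (fun x : (Σ f' : IdemClass e, {t : Arrow f.1 f'.1 // t.val ∈ lower s} ×
        {u : Arrow f'.1 f''.1 // u.val ∈ lower t}) =>
      (⟨x.2.1.1.comp x.2.2.1, Arrow.comp_mem_lower _ _ x.2.1.2 x.2.2.2⟩ :
        {t' : Arrow f.1 f''.1 // t'.val ∈ lower (s * t)})) ⟨?_, ?_⟩ _ _ (fun _ => rfl)
  · rintro ⟨f₁, ⟨a, ha⟩, ⟨b, hb⟩⟩ ⟨f₂, ⟨a', ha'⟩, ⟨b', hb'⟩⟩ h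
    have hav : a.val = a'.val :=
      ((a.mem_lower_iff s).1 ha).symm.trans ((a'.mem_lower_iff s).1 ha')
    have hf : f₁ = f₂ :=
      Subtype.ext (Idem.ext (by rw [← a.ran_eq, ← a'.ran_eq, hav]))
    subst hf
    have haa : a = a' := Arrow.ext hav
    have hbb : b = b' :=
      Arrow.ext (((b.mem_lower_iff t).1 hb).symm.trans ((b'.mem_lower_iff t).1 hb'))
    subst haa
    subst hbb
    rfl
  · rintro ⟨w, hw⟩
    obtain ⟨f', a, b, ha, hb, hab⟩ := w.exists_factor hw
    exact ⟨⟨⟨f', ⟨f.2.some.comp a⟩⟩, ⟨a, ha⟩, ⟨b, hb⟩⟩, Subtype.ext hab⟩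

/-- The representation `φ*` of `S` associated with a representation `φ` of the maximal subgroup
`G_e`: the matrices `starMatrix p φ s` acting on a direct sum of copies of `W` indexed by the
idempotents isomorphic to `e`. -/
noncomputable def starRep {e : Idem S} (p : Transversal e)
    (φ : Representation K (MaxSubgroup e) W) : S →ₙ* Module.End K (IdemClass e → W) where
  toFun s := (endVecRingEquivMatrixEnd (IdemClass e) K W).symm (starMatrix p φ s)
  map_mul' s t := by rw [starMatrix_mul, map_mul]

end Rep

end ECSemigroup

open ECSemigroup

namespace ECSemigroup

/-! Let `M = ∑_{f ≤ e} μ(f,e) f` (`moebiusIdem`) in the algebra of `S` with an identity adjoined.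
The right-hand side of the formula is the pairing of `χ` with `g ↦ tr(M g)`. Traces add up along a
composition series (`moduleCharacter_eq_sum`), so it suffices to show that a simple module `L`
contributes `d` if it is isomorphic to `φ*` and `0` otherwise (`moebiusSum_of_isSimpleModule`).

Call `e` an apex of `L` if `e` does not kill `L` but every smaller idempotent does. If `e` is an
apex, `M` acts on `L` as `e`, so `tr(M g)` is the character of `G` on `eL`. This is an irreducible
representation (`isIrreducible_localRep`), and its pairing with `χ` is `dim Hom_G(W, eL)`, which is
`d` or `0` by Schur. Moreover `L ≅ φ*` iff `eL ≅ W` (`nonempty_equiv_star_iff`). If `e` is not an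
apex, `M` kills `L` (`moebiusIdem_smul_eq_zero`), whereas `M` does not kill `φ*`.

Two facts carry this. On `φ*` an idempotent `f` is the projection on the coordinates `a ≤ f`, so by
Möbius inversion `M` is the projection on the coordinate `e` alone; this also gives irreducibility
of `φ*`. And if `f` is an apex of `L`, an element `f s` that does not kill `L` is regular with
domain `f` (`exists_arrow`). Hence `v ↦ (θ(p_a v))_a` is a module homomorphism `L → φ*` for every
`G`-equivariant `θ : L → W` (`homStar`), which embeds `L` in the star of its own local
representation when `θ` is multiplication by the apex. -/

lemma exists_pow_isIdempotentElem {M : Type*} [Monoid M] [Finite M] (x : M) :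
    ∃ n, n ≠ 0 ∧ IsIdempotentElem (x ^ n) := by
  obtain ⟨i, j, hij, h⟩ : ∃ i j : ℕ, i < j ∧ x ^ i = x ^ j := by
    obtain ⟨i, j, hne, h⟩ := Finite.exists_ne_map_eq_of_infinite (fun n : ℕ => x ^ n)
    rcases lt_or_gt_of_ne hne with hl | hl
    · exact ⟨i, j, hl, h⟩
    · exact ⟨j, i, hl, h.symm⟩
  obtain ⟨p, rfl⟩ := Nat.exists_eq_add_of_lt hij
  have hk : ∀ k n, i ≤ n → x ^ (n + k * (p + 1)) = x ^ n := by
    intro k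
    induction k with
    | zero => simp
    | succ k ih =>
      intro n hn
      obtain ⟨c, rfl⟩ := Nat.exists_eq_add_of_le hn
      rw [← ih _ hn, show i + c + (k + 1) * (p + 1) = (i + p + 1) + (c + k * (p + 1)) by ring,
        pow_add, ← h, ← pow_add, add_assoc]
  -- Powers are periodic with period `p + 1` from exponent `i` on; this exponent is a positive
  -- multiple of the period that is at least `i`.
  refine ⟨(i + 1) * (p + 1), by positivity, ?_⟩
  rw [IsIdempotentElem, ← pow_add]
  exact hk _ _ (by nlinarith)

/-! ### Simple modules and their apexes -/

section Module

variable {S : Type*} [Semigroup S] {K : Type*} [Field K]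
variable {L : Type*} [AddCommGroup L] [Module (MonoidAlgebra K (WithOne S)) L]

variable (K) in
/-- The element of the algebra of the semigroup with adjoined identity given by `s`. -/
noncomputable def single (s : S) : MonoidAlgebra K (WithOne S) :=
  MonoidAlgebra.of K (WithOne S) (s : WithOne S)

lemma single_mul (s t : S) : single K (s * t) = single K s * single K t := by
  rw [single, WithOne.coe_mul, map_mul]; rfl

lemma single_mul_smul (s t : S) (v : L) : single K (s * t) • v = single K s • single K t • v := by
  rw [single_mul, mul_smul]

/-- A simple module is generated by any nonzero vector, so an element that does not annihilate it
does not annihilate the orbit of this vector. -/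
lemma exists_of_smul_ne_zero {M : Type*} [Monoid M] {L : Type*} [AddCommGroup L]
    [Module (MonoidAlgebra K M) L] [IsSimpleModule (MonoidAlgebra K M) L]
    {y : MonoidAlgebra K M} {w : L} (hy : y • w ≠ 0) {v : L} (hv : v ≠ 0) :
    ∃ m : M, y • MonoidAlgebra.of K M m • v ≠ 0 := by
  by_contra! h
  obtain ⟨x, rfl⟩ := IsSimpleModule.toSpanSingleton_surjective (MonoidAlgebra K M) hv w
  apply hy
  clear hy
  simp only [LinearMap.toSpanSingleton_apply]
  induction x using MonoidAlgebra.induction_on with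
  | of g => exact h g
  | add a b ha hb => rw [add_smul, smul_add, ha, hb, add_zero]
  | smul r a ha =>
    rw [← mul_smul, mul_smul_comm, Algebra.smul_def, mul_smul, mul_smul, ha, smul_zero]

variable (K L) in
/-- The idempotent `e` is an apex of the module `L`: it does not annihilate `L`, but all smaller
idempotents do. -/
def IsApex (e : Idem S) : Prop :=
  (∃ v : L, single K e.val • v ≠ 0) ∧ ∀ f < e, ∀ v : L, single K f.val • v = 0

lemma IsApex.eq_of_le {e f : Idem S} (he : IsApex K L e) (hf : f ≤ e) {v : L}
    (hv : single K f.val • v ≠ 0) : f = e :=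
  hf.eq_or_lt.resolve_right fun h => hv (he.2 f h v)

lemma exists_isApex [Finite S] {f : Idem S} {v : L} (hv : single K f.val • v ≠ 0) :
    ∃ e : Idem S, IsApex K L e := by
  obtain ⟨e, he, hmin⟩ :=
    (Set.toFinite {e : Idem S | ∃ v : L, single K e.val • v ≠ 0}).exists_minimal ⟨f, v, hv⟩
  refine ⟨e, he, fun g hg w => ?_⟩
  by_contra hw
  exact hg.not_ge (hmin ⟨w, hw⟩ hg.le)

/-- The apex is stable under isomorphism of idempotents. -/
lemma IsApex.of_arrow [CommutingIdempotents S] {e f : Idem S} (hf : IsApex K L f) (q : Arrow f e) :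
    IsApex K L e := by
  refine ⟨?_, fun g hg v => ?_⟩
  · obtain ⟨v, hv⟩ := hf.1
    by_contra! h
    apply hv
    rw [← q.mul_inv_val, ← q.mul_right, mul_assoc, single_mul_smul, single_mul_smul, h, smul_zero]
  -- If `g < e` does not kill `v`, the conjugate `q g q⁻¹ ≤ f` does not kill `q v`, so it equals
  -- `f`; conjugating back gives `g = e`.
  · by_contra hv
    have hgg : q.val * g.val * q.inv.val * (q.val * g.val * q.inv.val)
        = q.val * g.val * q.inv.val := by
      calc _ = q.val * (g.val * ((q.inv.val * q.val) * g.val)) * q.inv.val := by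
            simp only [mul_assoc]
        _ = _ := by rw [q.inv_mul_val, hg.le.2, g.idem]
    have hg' : q.inv.val * (q.val * g.val * q.inv.val) * q.val = g.val := by
      calc _ = (q.inv.val * q.val) * g.val * (q.inv.val * q.val) := by simp only [mul_assoc]
        _ = _ := by rw [q.inv_mul_val, hg.le.2, hg.le.1]
    have hle : (⟨_, hgg⟩ : Idem S) ≤ f :=
      ⟨by change q.val * g.val * q.inv.val * f.val = q.val * g.val * q.inv.val
          rw [mul_assoc, q.inv.mul_right],
        by change f.val * (q.val * g.val * q.inv.val) = q.val * g.val * q.inv.val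
           rw [← mul_assoc, ← mul_assoc, q.left_mul]⟩
    have := hf.eq_of_le hle (v := single K q.val • v) fun h => hv (by
      rw [← hg', mul_assoc, mul_assoc, single_mul_smul, ← mul_assoc, single_mul_smul, h, smul_zero])
    apply hg.ne
    apply Idem.ext
    rw [← hg', show q.val * g.val * q.inv.val = f.val from congrArg Idem.val this,
      q.inv.mul_right, q.inv_mul_val]

variable [Finite S] [CommutingIdempotents S]

/-- An element of a finite monoid not annihilating a simple module divides a nonzero idempotent on
the left, and this idempotent does not annihilate the module either. -/
lemma exists_idempotent_mul {M : Type*} [Monoid M] [Finite M] {L : Type*} [AddCommGroup L]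
    [Module (MonoidAlgebra K M) L] [IsSimpleModule (MonoidAlgebra K M) L]
    {y : M} {v : L} (hy : MonoidAlgebra.of K M y • v ≠ 0) :
    ∃ r : M, IsIdempotentElem (y * r) ∧ ∃ w : L, MonoidAlgebra.of K M (y * r) • w ≠ 0 := by
  -- Among the right multiples `x` of `y` that do not kill the module, take one whose right ideal
  -- `xM` is smallest. Some `x s x` still does not kill it, so minimality forces `x s x M = x M`,
  -- whence `x = x s x t`. Iterating, no power of `x s` kills the module, and one of these powers is
  -- idempotent.
  obtain ⟨x, ⟨⟨r, rfl⟩, w, hw⟩, hmin⟩ := Set.exists_min_image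
    {x : M | (∃ r, x = y * r) ∧ ∃ w : L, MonoidAlgebra.of K M x • w ≠ 0}
    (fun x => (Set.range (x * ·)).ncard) (Set.toFinite _) ⟨y, ⟨1, (mul_one y).symm⟩, v, hy⟩
  set x := y * r with hx
  obtain ⟨s, hs⟩ := exists_of_smul_ne_zero hw hw
  simp only [← mul_smul, ← map_mul] at hs
  have hsub : Set.range (x * s * x * ·) ⊆ Set.range (x * ·) := by
    rintro _ ⟨t, rfl⟩
    exact ⟨s * x * t, by simp only [mul_assoc]⟩
  have heq := Set.eq_of_subset_of_ncard_le hsub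
    (hmin (x * s * x) ⟨⟨r * s * x, by simp only [hx, mul_assoc]⟩, w, by rwa [mul_assoc]⟩)
    (Set.toFinite _)
  obtain ⟨t, ht⟩ : x ∈ Set.range (x * s * x * ·) := heq ▸ ⟨1, mul_one x⟩
  have hpow : ∀ n, (x * s) ^ n * x * t ^ n = x := by
    intro n
    induction n with
    | zero => simp
    | succ n ih =>
      rw [pow_succ, pow_succ', show (x * s) ^ n * (x * s) * x * (t * t ^ n)
        = (x * s) ^ n * (x * s * x * t) * t ^ n by simp only [mul_assoc]]
      simp only at ht
      rw [ht, ih]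
  obtain ⟨n, hn, hi⟩ := exists_pow_isIdempotentElem (x * s)
  obtain ⟨k, rfl⟩ := Nat.exists_eq_succ_of_ne_zero hn
  have hyr : (x * s) ^ (k + 1) = y * (r * s * (x * s) ^ k) := by
    rw [pow_succ', hx]; simp only [mul_assoc]
  rw [Nat.succ_eq_add_one] at hi
  refine ⟨r * s * (x * s) ^ k, hyr ▸ hi, MonoidAlgebra.of K M (x * t ^ (k + 1)) • w, ?_⟩
  rw [← hyr, ← mul_smul, ← map_mul, ← mul_assoc, hpow]
  exact hw

/-- Some right multiple `j` of `f s` is an idempotent not killing `L`. From `f j = j` and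
commutation, `j ≤ f`, so `j = f` because `f` is an apex. Thus `f s` has a right inverse relative to
`f`, which makes it regular with domain `f`. -/
lemma exists_arrow [IsSimpleModule (MonoidAlgebra K (WithOne S)) L] {f : Idem S}
    (hf : IsApex K L f) {s : S} {v : L} (hv : single K (f.val * s) • v ≠ 0) :
    ∃ (b : Idem S) (t : Arrow f b), t.val = f.val * s := by
  have : Finite (WithOne S) := inferInstanceAs (Finite (Option S))
  obtain ⟨r, hi, w, hw⟩ := exists_idempotent_mul hv
  -- The cofactor `r` may be the adjoined identity. Then `f s` is itself idempotent, and `z = f s`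
  -- serves as a cofactor within `S`.
  obtain ⟨z, j, hj, hz⟩ : ∃ z j : S, (j : WithOne S) = ((f.val * s : S) : WithOne S) * r ∧
      (j * j = j → f.val * s * z = j) := by
    cases r with
    | one => exact ⟨f.val * s, f.val * s, (mul_one _).symm, id⟩
    | coe z => exact ⟨z, f.val * s * z, WithOne.coe_mul _ _, fun _ => rfl⟩
  rw [← hj] at hi hw
  have hjj : j * j = j := WithOne.coe_injective (by rw [WithOne.coe_mul]; exact hi)
  have hfj : f.val * j = j := by rw [← hz hjj, ← mul_assoc, ← mul_assoc, f.idem]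
  have hjf : j * f.val = j := (CommutingIdempotents.comm j f.val hjj f.idem).trans hfj
  have hjef := hf.eq_of_le (f := ⟨j, hjj⟩) ⟨hjf, hfj⟩ hw
  have hyz : f.val * s * (z * f.val) = f.val := by
    rw [← mul_assoc, hz hjj, hjf, ← hjef]
  have hinv : IsInverse (f.val * s) (z * f.val) :=
    ⟨by rw [hyz, ← mul_assoc, f.idem], by rw [mul_assoc, hyz, mul_assoc, f.idem]⟩
  exact ⟨⟨z * f.val * (f.val * s), by rw [mul_assoc, ← mul_assoc (f.val * s), hyz,
    ← mul_assoc f.val, f.idem]⟩, Arrow.mk' _ _ hinv hyz rfl, rfl⟩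

/-- An element of `f S f` that does not annihilate a module with apex `f` is invertible. -/
lemma exists_arrow_self [IsSimpleModule (MonoidAlgebra K (WithOne S)) L] {f : Idem S}
    (hf : IsApex K L f) {s : S} {v : L} (hv : single K (f.val * s * f.val) • v ≠ 0) :
    ∃ t : Arrow f f, t.val = f.val * s * f.val := by
  rw [mul_assoc] at hv
  obtain ⟨b, t, ht⟩ := exists_arrow hf hv
  have hbf : b.val * f.val = b.val := by
    rw [← t.inv_mul_val, mul_assoc, ht, mul_assoc, mul_assoc, f.idem]
  have hle : b ≤ f := ⟨hbf, (CommutingIdempotents.comm f.val b.val f.idem b.idem).trans hbf⟩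
  -- The range `b` of `t` does not kill `v`, since `t = t b` does not.
  have hb := hf.eq_of_le hle (v := v) fun h => hv (by
    rw [← ht, ← t.mul_right, single_mul_smul, h, smul_zero])
  subst hb
  exact ⟨t, by rw [ht, mul_assoc]⟩

end Module
-- Identity arrows, group elements as arrows, and the transversal
section Groupoid

variable {S : Type*} [Semigroup S] [CommutingIdempotents S]

/-- The identity arrow of an idempotent. -/
def Arrow.id (f : Idem S) : Arrow f f :=
  Arrow.mk' f.val f.val ⟨by rw [f.idem, f.idem], by rw [f.idem, f.idem]⟩ f.idem f.idem

/-- An element of the maximal subgroup `G_e` as an arrow `e ⟶ e`. -/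
def MaxSubgroup.toArrow {e : Idem S} (g : MaxSubgroup e) : Arrow e e :=
  Arrow.mk' g.val g.inv ⟨by rw [g.val_mul_inv, g.left_mul], by rw [g.inv_mul_val, g.left_mul_inv]⟩
    g.val_mul_inv g.inv_mul_val

/-- The idempotent `e` as an element of its own isomorphism class. -/
def IdemClass.base (e : Idem S) : IdemClass e := ⟨e, ⟨Arrow.id e⟩⟩

/-- The only arrow in `f↓` with domain `a`, for an idempotent `f`, is the identity of `a`. -/
lemma Arrow.idem_eq_of_eq_mul {a b f : Idem S} (t : Arrow a b) (ht : t.val = a.val * f.val) :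
    t.val = a.val ∧ a ≤ f := by
  have hc := CommutingIdempotents.comm a.val f.val a.idem f.idem
  have htt : t.val * t.val = t.val := by
    rw [ht, mul_assoc, ← mul_assoc f.val, ← hc, mul_assoc, f.idem, ← mul_assoc, a.idem]
  have hta : t.val = a.val := by
    have hinv : t.inv.val = t.val := pinv_eq ⟨by rw [htt, htt], by rw [htt, htt]⟩
    rw [← t.mul_inv_val, hinv, htt]
  exact ⟨hta, (ht.symm.trans hta), (hc.symm.trans ht.symm).trans hta⟩

variable {e : Idem S} (p : Transversal e)

lemma Transversal.arrow_base_val : (p.arrow (IdemClass.base e)).val = e.val :=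
  p.base _ rfl

lemma Transversal.arrow_base_inv_val : (p.arrow (IdemClass.base e)).inv.val = e.val := by
  have h := (p.arrow (IdemClass.base e)).inv_mul_val
  rw [p.arrow_base_val] at h
  exact (p.arrow (IdemClass.base e)).inv.mul_right.symm.trans h

lemma Transversal.conj_id (a : IdemClass e) : p.conj (Arrow.id a.1) = 1 := by
  apply MaxSubgroup.val_injective
  change (p.arrow a).val * a.1.val * (p.arrow a).inv.val = e.val
  rw [Arrow.mul_right, Arrow.mul_inv_val]

lemma Transversal.conj_toArrow (g : MaxSubgroup e) :
    p.conj (f := IdemClass.base e) (f' := IdemClass.base e) g.toArrow = g := by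
  apply MaxSubgroup.val_injective
  change (p.arrow (IdemClass.base e)).val * g.val * (p.arrow (IdemClass.base e)).inv.val = g.val
  rw [arrow_base_val, arrow_base_inv_val, g.left_mul, g.mul_right]

lemma Transversal.conj_arrow (a : IdemClass e) :
    p.conj (f := IdemClass.base e) (p.arrow a) = 1 := by
  apply MaxSubgroup.val_injective
  change (p.arrow (IdemClass.base e)).val * (p.arrow a).val * (p.arrow a).inv.val = e.val
  rw [arrow_base_val, mul_assoc, Arrow.mul_inv_val, e.idem]

lemma Transversal.conj_arrow_inv (a : IdemClass e) :
    p.conj (f' := IdemClass.base e) (p.arrow a).inv = 1 := by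
  apply MaxSubgroup.val_injective
  change (p.arrow a).val * (p.arrow a).inv.val * (p.arrow (IdemClass.base e)).inv.val = e.val
  rw [arrow_base_inv_val, Arrow.mul_inv_val, e.idem]

end Groupoid

section

variable {S : Type*} [Semigroup S] {K : Type*} [Field K]

lemma asModuleEquiv_single_smul {V : Type*} [AddCommGroup V] [Module K V] (ρ : S →ₙ* Module.End K V)
    (s : S) (x : (toRep ρ).asModule) :
    (toRep ρ).asModuleEquiv (single K s • x) = ρ s ((toRep ρ).asModuleEquiv x) := by
  rw [Representation.asModuleEquiv_map_smul, single, Representation.asAlgebraHom_of]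
  rfl

end

lemma nontrivial_of_isIrreducible {G : Type*} [Monoid G] {K : Type*} [Field K] {W : Type*}
    [AddCommGroup W] [Module K W] (φ : Representation K G W) [φ.IsIrreducible] :
    Nontrivial W := by
  by_contra h
  rw [not_nontrivial_iff_subsingleton] at h
  obtain ⟨U, V, hUV⟩ := exists_pair_ne (Subrepresentation φ)
  exact hUV (SetLike.ext fun w => by
    rw [Subsingleton.elim w 0]
    exact iff_of_true U.toSubmodule.zero_mem V.toSubmodule.zero_mem)

/-! ### The action on `φ*` and its irreducibility -/

section StarRep

variable {S : Type*} [Semigroup S] [Finite S] [CommutingIdempotents S] {K : Type*} [Field K]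
variable {W : Type*} [AddCommGroup W] [Module K W]
variable {e : Idem S} (p : Transversal e) (φ : Representation K (MaxSubgroup e) W)

lemma starRep_apply (s : S) (w : IdemClass e → W) (a : IdemClass e) :
    starRep p φ s w a = ∑ b : IdemClass e,
      ∑ t : {t : Arrow a.1 b.1 // t.val ∈ lower s}, φ (p.conj t.1) (w b) := by
  change ∑ b : IdemClass e, (starMatrix p φ s a b) (w b) = _
  simp only [starMatrix, Matrix.of_apply, LinearMap.sum_apply]

/-- An arrow in `s↓` with domain `a` must be `a s`, and its range is then determined. So each row of
the matrix of `s` has at most one term. -/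
lemma starRep_apply_of_arrow {s : S} {a b : IdemClass e} (t : Arrow a.1 b.1)
    (ht : t.val = a.1.val * s) (w : IdemClass e → W) :
    starRep p φ s w a = φ (p.conj t) (w b) := by
  rw [starRep_apply, Finset.sum_eq_single b]
  · rw [Fintype.sum_eq_single ⟨t, (t.mem_lower_iff s).2 ht.symm⟩]
    rintro ⟨u, hu⟩ hne
    exact absurd (Subtype.ext (Arrow.ext (((u.mem_lower_iff s).1 hu).symm.trans ht.symm))) hne
  · intro c _ hc
    refine Finset.sum_eq_zero fun u _ => absurd (Subtype.ext (Idem.ext ?_)) hc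
    rw [← u.1.ran_eq, ← t.ran_eq, ht, (u.1.mem_lower_iff s).1 u.2]
  · exact fun h => absurd (Finset.mem_univ b) h

lemma starRep_apply_eq_zero {s : S} {a : IdemClass e}
    (h : ∀ (b : Idem S) (t : Arrow a.1 b), t.val ≠ a.1.val * s) (w : IdemClass e → W) :
    starRep p φ s w a = 0 := by
  rw [starRep_apply]
  exact Finset.sum_eq_zero fun b _ => Finset.sum_eq_zero fun t _ =>
    absurd ((t.1.mem_lower_iff s).1 t.2).symm (h b.1 t.1)

open Classical in
lemma starRep_idem_apply (f : Idem S) (w : IdemClass e → W) (a : IdemClass e) :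
    starRep p φ f.val w a = if a.1 ≤ f then w a else 0 := by
  split_ifs with h
  · rw [starRep_apply_of_arrow p φ (b := a) (Arrow.id a.1) h.1.symm, p.conj_id, map_one]
    rfl
  · exact starRep_apply_eq_zero p φ (fun b t ht => h (t.idem_eq_of_eq_mul ht).2) w

variable (K) in
/-- The element `∑_{f ≤ e} μ(f, e) f` of the semigroup algebra. -/
noncomputable def moebiusIdem (e : Idem S) : MonoidAlgebra K (WithOne S) :=
  ∑ f : Idem S with f ≤ e, IncidenceAlgebra.mu K f e • single K f.val

/-- The coordinate at `a` is multiplied by the sum of `μ(f, c)` over `a ≤ f ≤ c`, which is `1` for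
`a = c` and `0` otherwise. -/
lemma asModuleEquiv_moebiusIdem_smul (c : Idem S) (x : (toRep (starRep p φ)).asModule)
    (a : IdemClass e) :
    (toRep (starRep p φ)).asModuleEquiv (moebiusIdem K c • x) a =
      if a.1 = c then (toRep (starRep p φ)).asModuleEquiv x a else 0 := by
  classical
  rw [moebiusIdem, Finset.sum_smul, map_sum, Finset.sum_apply]
  simp only [smul_assoc, map_smul, asModuleEquiv_single_smul, Pi.smul_apply, starRep_idem_apply]
  simp only [smul_ite, smul_zero]
  rw [← Finset.sum_filter, ← Finset.sum_smul, Finset.filter_filter]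
  have : ({f : Idem S | f ≤ c ∧ a.1 ≤ f} : Finset (Idem S)) = Finset.Icc a.1 c := by
    ext f
    simp [and_comm]
  rw [this, IncidenceAlgebra.sum_Icc_mu_left, ite_smul, one_smul, zero_smul]

-- Möbius elements isolate single coordinates and arrows carry them from one position to another. A
-- nonzero submodule is therefore determined by its part at the base coordinate, a nonzero
-- subrepresentation of `φ`.
variable {p φ} in
lemma starRep_submodule_eq_top [φ.IsIrreducible]
    (N : Submodule (MonoidAlgebra K (WithOne S)) (toRep (starRep p φ)).asModule) (hN : N ≠ ⊥) :
    N = ⊤ := by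
  set E := (toRep (starRep p φ)).asModuleEquiv
  obtain ⟨x, hx, hx0⟩ := N.exists_mem_ne_zero_of_ne_bot hN
  obtain ⟨f, hf⟩ : ∃ f, E x f ≠ 0 := by
    by_contra! h
    exact hx0 (E.injective (funext fun f => (h f).trans (congrFun (map_zero E) f).symm))
  -- cut down a vector of `N` to a single coordinate
  have cut : ∀ (a : IdemClass e) (y) (_ : y ∈ N), E.symm (Pi.single a (E y a)) ∈ N := by
    intro a y hy
    have : E.symm (Pi.single a (E y a)) = moebiusIdem K a.1 • y := by
      rw [LinearEquiv.symm_apply_eq]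
      funext b
      rw [asModuleEquiv_moebiusIdem_smul]
      by_cases hb : b = a
      · subst hb; simp [E]
      · rw [Pi.single_eq_of_ne hb, if_neg fun h => hb (Subtype.ext h)]
    rw [this]
    exact N.smul_mem _ hy
  have move : ∀ {a b : IdemClass e} (t : Arrow a.1 b.1) (y) (_ : y ∈ N),
      E.symm (Pi.single a (φ (p.conj t) (E y b))) ∈ N := by
    intro a b t y hy
    have := cut a _ (N.smul_mem (single K t.val) hy)
    rwa [asModuleEquiv_single_smul, starRep_apply_of_arrow p φ t t.left_mul.symm] at this
  -- The vectors of `W` that lie in `N` when placed at the base coordinate.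
  let U : Subrepresentation φ :=
    { toSubmodule := (N.restrictScalars K).comap
        (E.symm.toLinearMap ∘ₗ LinearMap.single K (fun _ => W) (IdemClass.base e))
      apply_mem_toSubmodule := by
        intro g w hw
        have := move (a := IdemClass.base e) (b := IdemClass.base e) g.toArrow _ hw
        rw [p.conj_toArrow] at this
        simpa using this }
  have hmem : ∀ w, w ∈ U ↔ E.symm (Pi.single (IdemClass.base e) w) ∈ N := fun w => Iff.rfl
  have hU : U = ⊤ := by
    refine (eq_bot_or_eq_top U).resolve_left fun h => hf ?_
    have hxf : E x f ∈ U := by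
      have := move (a := IdemClass.base e) (p.arrow f) x hx
      rwa [p.conj_arrow, map_one] at this
    rw [h] at hxf
    exact hxf
  rw [eq_top_iff]
  rintro y -
  have hy : y = ∑ a, E.symm (Pi.single a (E y a)) := by
    rw [← map_sum, LinearEquiv.eq_symm_apply, Finset.univ_sum_single]
  rw [hy]
  refine N.sum_mem fun a _ => ?_
  have hw : E y a ∈ U := hU ▸ trivial
  have := move (b := IdemClass.base e) (p.arrow a).inv _ ((hmem _).1 hw)
  rw [p.conj_arrow_inv, map_one] at this
  simpa using this

theorem isIrred_starRep (hφ : φ.IsIrreducible) : IsIrred (starRep p φ) := by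
  have := hφ
  have := nontrivial_of_isIrreducible φ
  obtain ⟨w, hw⟩ := exists_ne (0 : W)
  refine ⟨⟨e.val, fun h => hw ?_⟩, ?_⟩
  · have := congrFun (DFunLike.congr_fun h fun _ => w) (IdemClass.base e)
    classical
    rw [starRep_idem_apply] at this
    exact (if_pos (le_refl e)).symm.trans this
  · rw [Representation.irreducible_iff_isSimpleModule_asModule, isSimpleModule_iff]
    have : Nontrivial (toRep (starRep p φ)).asModule :=
      ⟨⟨(fun _ => w : IdemClass e → W), 0, fun h => hw (congrFun h (IdemClass.base e))⟩⟩
    exact { eq_bot_or_eq_top := fun N => or_iff_not_imp_left.2 (starRep_submodule_eq_top N) }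

end StarRep
-- The representation of `G_e` on `eL`, and its relation to `φ*`
section LocalRep

variable {S : Type*} [Semigroup S] {K : Type*} [Field K]
variable {L : Type*} [AddCommGroup L] [Module K L] [Module (MonoidAlgebra K (WithOne S)) L]
  [IsScalarTower K (MonoidAlgebra K (WithOne S)) L]

variable (K L) in
/-- The action of `s` on a module over the algebra of the semigroup. -/
noncomputable def act (s : S) : Module.End K L := Algebra.lsmul K K L (single K s)

@[simp]
lemma act_apply (s : S) (v : L) : act K L s v = single K s • v := rfl

variable (K L) in
/-- The subspace `eL` of a module `L`. -/
noncomputable def fixedSpace (e : Idem S) : Submodule K L := LinearMap.range (act K L e.val)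

lemma mem_fixedSpace_iff {e : Idem S} {v : L} :
    v ∈ fixedSpace K L e ↔ single K e.val • v = v := by
  refine ⟨?_, fun h => ⟨v, h⟩⟩
  rintro ⟨w, rfl⟩
  rw [act_apply, ← single_mul_smul, e.idem]

lemma single_smul_mem_fixedSpace {e : Idem S} (g : MaxSubgroup e) (v : L) :
    single K g.val • v ∈ fixedSpace K L e :=
  ⟨single K g.val • v, by rw [act_apply, ← single_mul_smul, g.left_mul]⟩

variable (K L) in
/-- The representation of the maximal subgroup `G_e` on `eL`. -/
noncomputable def localRep (e : Idem S) :
    Representation K (MaxSubgroup e) (fixedSpace K L e) where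
  toFun g := (act K L g.val).restrict fun v _ => single_smul_mem_fixedSpace g v
  map_one' := by
    ext v
    exact mem_fixedSpace_iff.1 v.2
  map_mul' g h := by
    ext v
    exact single_mul_smul g.val h.val v.1

@[simp]
lemma localRep_apply_coe {e : Idem S} (g : MaxSubgroup e) (v : fixedSpace K L e) :
    (localRep K L e g v : L) = single K g.val • (v : L) := rfl

/-- Since `g = e g` maps all of `L` into `eL`, its trace is already attained on `eL`. -/
lemma localRep_character [FiniteDimensional K L] {e : Idem S} (g : MaxSubgroup e) :
    (localRep K L e).character g = LinearMap.trace K L (act K L g.val) :=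
  LinearMap.trace_restrict_eq_of_forall_mem (fixedSpace K L e) (act K L g.val)
    (fun v => single_smul_mem_fixedSpace g v)

lemma map_smul_of_map_single_smul {L' : Type*} [AddCommGroup L'] [Module K L']
    [Module (MonoidAlgebra K (WithOne S)) L'] [IsScalarTower K (MonoidAlgebra K (WithOne S)) L']
    (f : L →ₗ[K] L') (hf : ∀ (s : S) v, f (single K s • v) = single K s • f v)
    (x : MonoidAlgebra K (WithOne S)) (v : L) : f (x • v) = x • f v := by
  induction x using MonoidAlgebra.induction_on with
  | of m =>
    cases m with
    | one => rw [map_one, one_smul, one_smul]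
    | coe s => exact hf s v
  | add a b ha hb => rw [add_smul, add_smul, map_add, ha, hb]
  | smul r a ha => rw [smul_assoc, smul_assoc, map_smul, ha]

variable (K L) in
/-- Multiplication by `e` as a map onto `eL`. -/
noncomputable def toFixedSpace (e : Idem S) : L →ₗ[K] fixedSpace K L e :=
  (act K L e.val).rangeRestrict

@[simp]
lemma toFixedSpace_coe (e : Idem S) (v : L) :
    (toFixedSpace K L e v : L) = single K e.val • v := rfl

lemma toFixedSpace_single_smul {e : Idem S} (g : MaxSubgroup e) (v : L) :
    toFixedSpace K L e (single K g.val • v) = localRep K L e g (toFixedSpace K L e v) := by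
  apply Subtype.ext
  rw [toFixedSpace_coe, localRep_apply_coe, toFixedSpace_coe, ← single_mul_smul,
    ← single_mul_smul, g.left_mul, g.mul_right]

lemma toFixedSpace_ne_zero {e : Idem S} (he : IsApex K L e) : toFixedSpace K L e ≠ 0 := by
  obtain ⟨v, hv⟩ := he.1
  exact fun h => hv (congrArg Subtype.val (DFunLike.congr_fun h v))

lemma IsApex.moebiusIdem_smul [Finite S] {e : Idem S} (he : IsApex K L e) (v : L) :
    moebiusIdem K e • v = single K e.val • v := by
  rw [moebiusIdem, Finset.sum_smul, Finset.sum_eq_single e]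
  · rw [IncidenceAlgebra.mu_self, one_smul]
  · intro f hf hne
    rw [smul_assoc, he.2 f ((Finset.mem_filter.1 hf).2.lt_of_ne hne), smul_zero]
  · exact fun h => absurd (Finset.mem_filter.2 ⟨Finset.mem_univ e, le_refl e⟩ :
      e ∈ ({f | f ≤ e} : Finset (Idem S))) h

variable [CommutingIdempotents S] [Finite S] [IsSimpleModule (MonoidAlgebra K (WithOne S)) L]

/-- A nonzero `u ∈ eL` generates `L`, so `eL` is spanned by `u` and the vectors `e s u = (e s e) u`.
Each `e s e` either kills `u` or belongs to `G_e`, by `exists_arrow_self`. -/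
lemma isIrreducible_localRep {e : Idem S} (he : IsApex K L e) :
    (localRep K L e).IsIrreducible := by
  obtain ⟨v, hv⟩ := he.1
  have hne : Nontrivial (Subrepresentation (localRep K L e)) := by
    refine ⟨⟨⊥, ⊤, fun h => hv ?_⟩⟩
    have : (⟨single K e.val • v, v, rfl⟩ : fixedSpace K L e) ∈
        (⊤ : Subrepresentation (localRep K L e)) := trivial
    rw [← h] at this
    exact congrArg Subtype.val (show _ = (0 : fixedSpace K L e) from this)
  refine { eq_bot_or_eq_top := fun U => or_iff_not_imp_left.2 fun hU => ?_ }
  obtain ⟨u, hu, hu0⟩ : ∃ u ∈ U, u ≠ 0 := by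
    by_contra! h
    exact hU (SetLike.ext fun w => ⟨h w, fun hw => (show w = 0 from hw) ▸ U.toSubmodule.zero_mem⟩)
  have hu0' : (u : L) ≠ 0 := fun h => hu0 (Subtype.ext h)
  have key : ∀ x : MonoidAlgebra K (WithOne S),
      ∃ w ∈ U, (w : L) = single K e.val • x • (u : L) := by
    intro x
    induction x using MonoidAlgebra.induction_on with
    | of m =>
      cases m with
      | one => exact ⟨u, hu, by rw [map_one, one_smul, mem_fixedSpace_iff.1 u.2]⟩
      | coe s =>
        have hs : single K e.val • single K s • (u : L) =
            single K (e.val * s * e.val) • (u : L) := by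
          rw [single_mul_smul, mem_fixedSpace_iff.1 u.2, single_mul_smul]
        change ∃ w ∈ U, (w : L) = single K e.val • single K s • (u : L)
        rw [hs]
        by_cases h : single K (e.val * s * e.val) • (u : L) = 0
        · exact ⟨0, U.toSubmodule.zero_mem, h.symm⟩
        · obtain ⟨t, ht⟩ := exists_arrow_self he h
          exact ⟨_, U.apply_mem_toSubmodule t.toMaxSubgroup hu, by rw [← ht]; rfl⟩
    | add a b ha hb =>
      obtain ⟨w, hw, hwa⟩ := ha
      obtain ⟨w', hw', hwb⟩ := hb
      exact ⟨w + w', U.toSubmodule.add_mem hw hw', by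
        rw [add_smul, smul_add, ← hwa, ← hwb, Submodule.coe_add]⟩
    | smul r a ha =>
      obtain ⟨w, hw, hwa⟩ := ha
      exact ⟨r • w, U.toSubmodule.smul_mem r hw, by
        rw [smul_assoc, smul_comm, ← hwa, Submodule.coe_smul]⟩
  refine SetLike.ext fun w => iff_of_true ?_ trivial
  obtain ⟨x, hx⟩ := IsSimpleModule.toSpanSingleton_surjective
    (MonoidAlgebra K (WithOne S)) hu0' (w : L)
  obtain ⟨w', hw', hww⟩ := key x
  rw [LinearMap.toSpanSingleton_apply] at hx
  rw [hx, mem_fixedSpace_iff.1 w.2] at hww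
  rwa [← Subtype.ext hww]

variable {W : Type*} [AddCommGroup W] [Module K W]

/-- A `G_e`-equivariant map `θ : L → W` from a simple module with apex `e` yields a homomorphism
from `L` to the module of `φ*`, namely `v ↦ (θ (p_a v))_a`. -/
noncomputable def homStar {e : Idem S} (he : IsApex K L e) (p : Transversal e)
    (φ : Representation K (MaxSubgroup e) W) (θ : L →ₗ[K] W)
    (hθ : ∀ (g : MaxSubgroup e) (v : L), θ (single K g.val • v) = φ g (θ v)) :
    L →ₗ[MonoidAlgebra K (WithOne S)] (toRep (starRep p φ)).asModule :=
  let f : L →ₗ[K] (toRep (starRep p φ)).asModule :=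
    (toRep (starRep p φ)).asModuleEquiv.symm.toLinearMap ∘ₗ
      LinearMap.pi fun a => θ ∘ₗ act K L (p.arrow a).val
  { toFun := f
    map_add' := map_add f
    map_smul' := map_smul_of_map_single_smul f fun s v => by
      apply (toRep (starRep p φ)).asModuleEquiv.injective
      rw [asModuleEquiv_single_smul]
      funext a
      change θ (single K (p.arrow a).val • single K s • v) =
        starRep p φ s (fun a => θ (single K (p.arrow a).val • v)) a
      have hs : single K (p.arrow a).val • single K s • v =
          single K (p.arrow a).val • single K (a.1.val * s) • v := by
        rw [← single_mul_smul, ← single_mul_smul, ← mul_assoc, Arrow.mul_right]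
      rw [hs]
      -- If `a s` is an arrow `t : a ⟶ b`, then `p_a t = (p_a t p_b⁻¹) p_b`, and equivariance of `θ`
      -- takes the group element out. If not, row `a` of the matrix vanishes, and `a s` kills `L`
      -- because `a` is an apex too.
      by_cases h : ∃ (b : Idem S) (t : Arrow a.1 b), t.val = a.1.val * s
      · obtain ⟨b, t, ht⟩ := h
        let b' : IdemClass e := ⟨b, ⟨(p.arrow a).comp t⟩⟩
        rw [starRep_apply_of_arrow p φ (b := b') t ht, ← hθ, ← single_mul_smul, ← ht,
          ← single_mul_smul]
        congr 2
        change _ = single K ((p.arrow a).val * t.val * (p.arrow b').inv.val * (p.arrow b').val)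
        rw [mul_assoc _ _ (p.arrow b').val, Arrow.inv_mul_val, mul_assoc]
        exact congrArg _ (congrArg _ t.mul_right.symm)
      · rw [starRep_apply_eq_zero p φ fun b t ht => h ⟨b, t, ht⟩]
        have h0 : single K (a.1.val * s) • v = 0 := by
          by_contra hv
          exact h (exists_arrow (he.of_arrow (p.arrow a)) hv)
        rw [h0, smul_zero, map_zero] }

lemma homStar_ne_zero {e : Idem S} (he : IsApex K L e) (p : Transversal e)
    (φ : Representation K (MaxSubgroup e) W) (θ : L →ₗ[K] W)
    (hθ : ∀ (g : MaxSubgroup e) (v : L), θ (single K g.val • v) = φ g (θ v)) (h0 : θ ≠ 0) :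
    homStar he p φ θ hθ ≠ 0 := by
  intro h
  apply h0
  ext v
  have hv : θ (single K (p.arrow (IdemClass.base e)).val • v) = 0 :=
    congrFun (DFunLike.congr_fun h v) (IdemClass.base e)
  rw [p.arrow_base_val] at hv
  have := hθ 1 v
  rw [map_one] at this
  exact this.symm.trans hv

/-- `∑_{f ≤ e} μ(f, e) f` annihilates the simple modules of which `e` is not an apex. -/
lemma moebiusIdem_smul_eq_zero {e : Idem S} (he : ¬ IsApex K L e) (v : L) :
    moebiusIdem K e • v = 0 := by
  by_cases h : ∃ (f : Idem S) (v : L), single K f.val • v ≠ 0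
  · obtain ⟨f, w, hw⟩ := h
    obtain ⟨f, hf⟩ := exists_isApex hw
    obtain ⟨p⟩ := nonempty_transversal f
    -- Embed `L` in the star of its local representation at an apex `f`. There the element projects
    -- on the coordinate `e`, which does not occur: the coordinates are idempotents isomorphic to
    -- `f`, all of them apexes.
    have hinj := (LinearMap.injective_or_eq_zero (homStar hf p (localRep K L f)
      (toFixedSpace K L f) toFixedSpace_single_smul)).resolve_right
      (homStar_ne_zero _ _ _ _ _ (toFixedSpace_ne_zero hf))
    apply hinj
    rw [map_smul, map_zero]
    apply (toRep (starRep p (localRep K L f))).asModuleEquiv.injective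
    funext a
    rw [asModuleEquiv_moebiusIdem_smul, if_neg, map_zero]
    · rfl
    · rintro rfl
      exact he (hf.of_arrow (p.arrow a))
  -- If every idempotent kills `L`, there is no apex, and each term of the sum vanishes.
  · push Not at h
    rw [moebiusIdem, Finset.sum_smul]
    exact Finset.sum_eq_zero fun f _ => by rw [smul_assoc, h, smul_zero]

/-- Otherwise the Möbius element of `e` would kill `φ*`, where it is the projection on the nonzero
base coordinate. -/
lemma isApex_of_equiv_star {e : Idem S} {p : Transversal e}
    {φ : Representation K (MaxSubgroup e) W} [Nontrivial W]
    (i : L ≃ₗ[MonoidAlgebra K (WithOne S)] (toRep (starRep p φ)).asModule) : IsApex K L e := by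
  by_contra he
  obtain ⟨w, hw⟩ := exists_ne (0 : W)
  set E := (toRep (starRep p φ)).asModuleEquiv
  apply hw
  have h := moebiusIdem_smul_eq_zero he (i.symm (E.symm fun _ => w))
  rw [← map_smul, LinearEquiv.map_eq_zero_iff] at h
  have h' := asModuleEquiv_moebiusIdem_smul p φ e (E.symm fun _ => w) (IdemClass.base e)
  rw [h] at h'
  exact (h'.trans (if_pos rfl)).symm

/-- A simple module with apex `e` is isomorphic to `φ*` iff `φ` is isomorphic to the representation
of `G_e` on `eL`. -/
lemma nonempty_equiv_star_iff {e : Idem S} (he : IsApex K L e) (p : Transversal e)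
    (φ : Representation K (MaxSubgroup e) W) [φ.IsIrreducible] [Nontrivial W] :
    Nonempty (L ≃ₗ[MonoidAlgebra K (WithOne S)] (toRep (starRep p φ)).asModule) ↔
      Nonempty (φ.Equiv (localRep K L e)) := by
  have hirr := isIrreducible_localRep he
  constructor
  · rintro ⟨i⟩
    set E := (toRep (starRep p φ)).asModuleEquiv
    have hi : ∀ (g : MaxSubgroup e) (v : L), E (i (single K g.val • v)) (IdemClass.base e) =
        φ g (E (i v) (IdemClass.base e)) := by
      intro g v
      rw [map_smul, asModuleEquiv_single_smul, starRep_apply_of_arrow p φ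
        (a := IdemClass.base e) (b := IdemClass.base e) g.toArrow g.left_mul.symm, p.conj_toArrow]
    -- Reading off the base coordinate on `eL` is equivariant; it is nonzero, hence bijective by
    -- Schur.
    let θ : Representation.IntertwiningMap (localRep K L e) φ :=
      { toLinearMap :=
          { toFun := fun v => E (i (v : L)) (IdemClass.base e)
            map_add' := fun v w => by
              rw [Submodule.coe_add, map_add, map_add]; rfl
            map_smul' := fun r v => by
              rw [Submodule.coe_smul, ← algebraMap_smul (MonoidAlgebra K (WithOne S)) r (v : L),
                map_smul, algebraMap_smul, map_smul]
              rfl }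
        isIntertwining' := fun g => by
          ext v
          exact hi g v }
    refine ⟨(θ.ofBijective ((Representation.IsIrreducible.bijective_or_eq_zero θ).resolve_right
      fun h => ?_)).symm⟩
    obtain ⟨w, hw⟩ := exists_ne (0 : W)
    apply hw
    have h1 : E (i (single K (1 : MaxSubgroup e).val • i.symm (E.symm fun _ => w)))
        (IdemClass.base e) = 0 :=
      DFunLike.congr_fun h (toFixedSpace K L e (i.symm (E.symm fun _ => w)))
    rw [hi, map_one, i.apply_symm_apply, E.apply_symm_apply] at h1
    exact h1
  · rintro ⟨i⟩
    have hsimple := (Representation.irreducible_iff_isSimpleModule_asModule _).1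
      (isIrred_starRep p φ inferInstance).2
    -- Multiplication by `e` followed by `eL ≅ W` induces a nonzero homomorphism `L → φ*` between
    -- simple modules.
    let θ : L →ₗ[K] W := i.symm.toLinearMap ∘ₗ toFixedSpace K L e
    have hθ : ∀ (g : MaxSubgroup e) (v : L), θ (single K g.val • v) = φ g (θ v) := by
      intro g v
      change i.symm (toFixedSpace K L e (single K g.val • v)) = φ g (i.symm (toFixedSpace K L e v))
      rw [toFixedSpace_single_smul]
      exact Representation.IntertwiningMap.isIntertwining _ _ i.symm.toIntertwiningMap g _
    refine ⟨LinearEquiv.ofBijective (homStar he p φ θ hθ)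
      (LinearMap.bijective_of_ne_zero (homStar_ne_zero _ _ _ _ _ fun h => ?_))⟩
    apply toFixedSpace_ne_zero he
    ext1 v
    have hv : i.symm (toFixedSpace K L e v) = 0 := DFunLike.congr_fun h v
    rw [← i.apply_symm_apply (toFixedSpace K L e v), hv, map_zero]
    rfl

end LocalRep
end ECSemigroup

/-! ### Additivity of characters along composition series -/

/-- The trace is additive on short exact sequences. -/
lemma LinearMap.trace_eq_add_of_exact {K N L Q : Type*} [Field K] [AddCommGroup N] [Module K N]
    [AddCommGroup L] [Module K L] [AddCommGroup Q] [Module K Q] [FiniteDimensional K N]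
    [FiniteDimensional K L] [FiniteDimensional K Q]
    {i : N →ₗ[K] L} {q : L →ₗ[K] Q} (hi : Function.Injective i) (hq : Function.Surjective q)
    (hiq : Function.Exact i q) {a : Module.End K N} {b : Module.End K L} {c : Module.End K Q}
    (hab : b ∘ₗ i = i ∘ₗ a) (hbc : c ∘ₗ q = q ∘ₗ b) :
    trace K L b = trace K N a + trace K Q c := by
  obtain ⟨r, hr⟩ := i.exists_leftInverse_of_injective (ker_eq_bot.2 hi)
  -- `1 - i r` vanishes on `ker q = im i`, so it descends to a section `s` of `q`. Then `b = b i r +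
  -- b s q`, and cyclicity of the trace turns the two terms into the traces of `a` and `c`.
  let s : Q →ₗ[K] L := (ker q).liftQ (LinearMap.id - i ∘ₗ r) (by
      intro x hx
      obtain ⟨y, rfl⟩ := (hiq x).1 hx
      have : r (i y) = y := DFunLike.congr_fun hr y
      simp [this]) ∘ₗ (q.quotKerEquivOfSurjective hq).symm.toLinearMap
  have hsq : s ∘ₗ q = LinearMap.id - i ∘ₗ r := by
    ext x
    have : (q.quotKerEquivOfSurjective hq).symm (q x) = (ker q).mkQ x := by
      rw [LinearEquiv.symm_apply_eq]; rfl
    simp [s, this]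
  have hqs : q ∘ₗ s = LinearMap.id := by
    ext x
    obtain ⟨x, rfl⟩ := hq x
    have h1 : s (q x) = x - i (r x) := DFunLike.congr_fun hsq x
    have h2 : q (i (r x)) = 0 := hiq.apply_apply_eq_zero _
    simp [h1, h2]
  have hb : b = b ∘ₗ (i ∘ₗ r) + b ∘ₗ (s ∘ₗ q) := by
    rw [hsq, ← comp_add, add_sub_cancel, comp_id]
  rw [hb, map_add]
  congr 1
  · rw [← comp_assoc, hab, comp_assoc, trace_comp_comm', comp_assoc, hr, comp_id]
  · rw [← comp_assoc, trace_comp_comm', ← comp_assoc, ← hbc, comp_assoc, hqs, comp_id]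

namespace ECSemigroup

section Trace

variable {S : Type*} [Semigroup S] {K : Type*} [Field K]
variable {L : Type*} [AddCommGroup L] [Module K L] [Module (MonoidAlgebra K (WithOne S)) L]
  [IsScalarTower K (MonoidAlgebra K (WithOne S)) L]

variable (K L) in
/-- The character of a module over the algebra of a semigroup. -/
noncomputable def moduleCharacter (s : S) : K := LinearMap.trace K L (act K L s)

lemma moduleCharacter_congr {L' : Type*} [AddCommGroup L'] [Module K L']
    [Module (MonoidAlgebra K (WithOne S)) L'] [IsScalarTower K (MonoidAlgebra K (WithOne S)) L']
    (i : L ≃ₗ[MonoidAlgebra K (WithOne S)] L') :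
    moduleCharacter (S := S) K L = moduleCharacter K L' := by
  funext s
  rw [moduleCharacter, moduleCharacter, ← LinearMap.trace_conj' _ (i.restrictScalars K)]
  congr 1
  ext v
  simp [LinearEquiv.conj_apply]

lemma finiteDimensional_submodule [FiniteDimensional K L]
    (N : Submodule (MonoidAlgebra K (WithOne S)) L) : FiniteDimensional K N :=
  inferInstanceAs (FiniteDimensional K (N.restrictScalars K))

lemma finiteDimensional_quotient [FiniteDimensional K L]
    (N : Submodule (MonoidAlgebra K (WithOne S)) L) : FiniteDimensional K (L ⧸ N) :=
  Module.Finite.of_surjective (N.mkQ.restrictScalars K) N.mkQ_surjective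

lemma moduleCharacter_eq_add_quotient [FiniteDimensional K L]
    (N : Submodule (MonoidAlgebra K (WithOne S)) L) (s : S) :
    moduleCharacter K L s = moduleCharacter K N s + moduleCharacter K (L ⧸ N) s := by
  have := finiteDimensional_submodule (K := K) N
  have := finiteDimensional_quotient (K := K) N
  exact LinearMap.trace_eq_add_of_exact (i := N.subtype.restrictScalars K)
    (q := N.mkQ.restrictScalars K) N.injective_subtype N.mkQ_surjective
    (LinearMap.exact_subtype_mkQ N) rfl rfl

/-- The character of a module is the sum of the characters of its composition factors. -/
lemma moduleCharacter_eq_sum [FiniteDimensional K L]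
    (c : CompositionSeries (Submodule (MonoidAlgebra K (WithOne S)) L))
    (h0 : c.head = ⊥) (h1 : c.last = ⊤) (s : S) :
    moduleCharacter K L s = ∑ i : Fin c.length,
      moduleCharacter K (c i.succ ⧸ (c i.castSucc).submoduleOf (c i.succ)) s := by
  have hfin := finiteDimensional_submodule (S := S) (K := K) (L := L)
  have hstep : ∀ i : Fin c.length,
      moduleCharacter K (c i.succ ⧸ (c i.castSucc).submoduleOf (c i.succ)) s =
        moduleCharacter K (c i.succ) s - moduleCharacter K (c i.castSucc) s := by
    intro i
    have h := congrFun (moduleCharacter_congr (K := K) (L := (c i.castSucc).submoduleOf (c i.succ))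
      (L' := c i.castSucc)
      (Submodule.submoduleOfEquivOfLe (c.step i).le)) s
    rw [moduleCharacter_eq_add_quotient ((c i.castSucc).submoduleOf (c i.succ)) s, h,
      add_sub_cancel_left]
  simp only [hstep]
  have htel : ∀ (n : ℕ) (f : Fin (n + 1) → K),
      ∑ i : Fin n, (f i.succ - f i.castSucc) = f (Fin.last n) - f 0 := by
    intro n f
    have := (Fin.sum_univ_succ f).symm.trans (Fin.sum_univ_castSucc f)
    rw [Finset.sum_sub_distrib]
    linear_combination this
  rw [htel _ fun j => moduleCharacter K (c j) s]
  have hl : c (Fin.last c.length) = ⊤ := h1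
  have hh : c 0 = ⊥ := h0
  rw [hl, hh, moduleCharacter_congr
    (Submodule.topEquiv (R := MonoidAlgebra K (WithOne S)) (M := L))]
  have : moduleCharacter K (⊥ : Submodule (MonoidAlgebra K (WithOne S)) L) s = 0 := by
    rw [moduleCharacter, Subsingleton.elim (act K _ s) 0, map_zero]
  rw [this, sub_zero]

lemma moduleCharacter_asModule {V : Type*} [AddCommGroup V] [Module K V]
    (ρ : S →ₙ* Module.End K V) :
    moduleCharacter K (toRep ρ).asModule = character ρ := by
  funext s
  rw [moduleCharacter, character, ← LinearMap.trace_conj' _ (toRep ρ).asModuleEquiv]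
  congr 1
  ext v
  rw [LinearEquiv.conj_apply_apply, act_apply, asModuleEquiv_single_smul,
    LinearEquiv.apply_symm_apply]

end Trace

/-! ### The Möbius sum on simple modules and the multiplicity formula -/

section Multiplicity

variable {S : Type*} [Semigroup S] [Finite S] {K : Type*} [Field K]
variable {W : Type*} [AddCommGroup W] [Module K W] {e : Idem S}

/-- The sum `∑_{f ≤ e} (χ, α_f)_G μ(f, e)` for the character `χ` of `φ` and a function `α`. -/
noncomputable def moebiusSum (φ : Representation K (MaxSubgroup e) W) (α : S → K) : K :=
  ∑ f : Idem S with f ≤ e,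
    pairing φ.character (fun g : MaxSubgroup e => α (f.val * g.val)) * IncidenceAlgebra.mu K f e

lemma moebiusSum_eq (φ : Representation K (MaxSubgroup e) W) (α : S → K) :
    moebiusSum φ α = pairing φ.character fun g =>
      ∑ f : Idem S with f ≤ e, IncidenceAlgebra.mu K f e * α (f.val * g.val) := by
  simp only [moebiusSum, pairing, Finset.mul_sum, Finset.sum_mul]
  rw [Finset.sum_comm]
  exact Finset.sum_congr rfl fun g _ => Finset.sum_congr rfl fun f _ => by ring

lemma moebiusSum_sum {ι : Type*} [Fintype ι] (φ : Representation K (MaxSubgroup e) W)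
    (α : ι → S → K) :
    moebiusSum φ (fun s => ∑ i, α i s) = ∑ i, moebiusSum φ (α i) := by
  simp only [moebiusSum, pairing, Finset.mul_sum, Finset.sum_mul]
  exact (Finset.sum_congr rfl fun f _ => Finset.sum_comm).trans Finset.sum_comm

variable {L : Type*} [AddCommGroup L] [Module K L] [Module (MonoidAlgebra K (WithOne S)) L]
  [IsScalarTower K (MonoidAlgebra K (WithOne S)) L]

lemma moebiusSum_moduleCharacter (φ : Representation K (MaxSubgroup e) W) :
    moebiusSum φ (moduleCharacter K L) = pairing φ.character fun g =>
      LinearMap.trace K L (Algebra.lsmul K K L (moebiusIdem K e * single K g.val)) := by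
  rw [moebiusSum_eq]
  congr 1
  funext g
  simp only [moebiusIdem, Finset.sum_mul, map_sum, smul_mul_assoc, map_smul, ← single_mul,
    smul_eq_mul]
  rfl

variable [CommutingIdempotents S] [IsSimpleModule (MonoidAlgebra K (WithOne S)) L]
  [FiniteDimensional K L] [FiniteDimensional K W] [CharZero K]

lemma pairing_character {G : Type*} [Group G] [Fintype G] {V : Type*} [AddCommGroup V] [Module K V]
    [FiniteDimensional K V] (φ : Representation K G W) (ψ : Representation K G V) :
    pairing φ.character ψ.character = Module.finrank K (φ.IntertwiningMap ψ) := by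
  have : Invertible (Nat.card G : K) :=
    invertibleOfNonzero (Nat.cast_ne_zero.2 Nat.card_pos.ne')
  rw [← Representation.card_inv_mul_sum_char_mul_char_eq_finrank, pairing,
    Nat.card_eq_fintype_card]
  simp only [mul_comm]

-- At an apex the sum becomes `dim Hom_G(W, eL)`, and Schur's lemma decides between the two values.
-- Away from the apexes both sides vanish.
open Classical in
lemma moebiusSum_of_isSimpleModule (p : Transversal e) (φ : Representation K (MaxSubgroup e) W)
    [φ.IsIrreducible] [Nontrivial W] :
    moebiusSum φ (moduleCharacter K L) =
      if Nonempty (L ≃ₗ[MonoidAlgebra K (WithOne S)] (toRep (starRep p φ)).asModule) then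
        (Module.finrank K (φ.IntertwiningMap φ) : K) else 0 := by
  rw [moebiusSum_moduleCharacter]
  by_cases he : IsApex K L e
  · have hchar : (fun g : MaxSubgroup e => LinearMap.trace K L
        (Algebra.lsmul K K L (moebiusIdem K e * single K g.val))) =
        (localRep K L e).character := by
      funext g
      rw [localRep_character]
      congr 1
      ext v
      change (moebiusIdem K e * single K g.val) • v = single K g.val • v
      rw [mul_smul, he.moebiusIdem_smul, ← single_mul_smul, g.left_mul]
    rw [hchar, if_congr (nonempty_equiv_star_iff he p φ) rfl rfl]
    split_ifs with h
    · rw [← Representation.char_iso h.some, pairing_character]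
    · have := isIrreducible_localRep he
      rw [not_nonempty_iff] at h
      rw [pairing_character, Module.finrank_zero_of_subsingleton, Nat.cast_zero]
  · rw [if_neg fun h => he (isApex_of_equiv_star h.some)]
    have hzero : ∀ x : MonoidAlgebra K (WithOne S),
        Algebra.lsmul K K L (moebiusIdem K e * x) = 0 := by
      intro x
      ext v
      change (moebiusIdem K e * x) • v = 0
      rw [mul_smul, moebiusIdem_smul_eq_zero he]
    simp [pairing, hzero]

end Multiplicity

end ECSemigroup

theorem theorem8p7 {S : Type*} [Semigroup S] [Finite S] [CommutingIdempotents S]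
    {K : Type*} [Field K] [CharZero K]
    -- the maximal subgroup `G = MaxSubgroup e` with identity `e`
    (e : Idem S)
    -- an irreducible representation `φ` of `G`, with character `φ.character`
    {W : Type*} [AddCommGroup W] [Module K W] [FiniteDimensional K W]
    (φ : Representation K (MaxSubgroup e) W) (hφ : φ.IsIrreducible)
    -- any choice of the elements used to build the associated representation of `S`
    (p : Transversal e)
    -- a representation `ρ` of `S`, with character `character ρ`
    {V : Type*} [AddCommGroup V] [Module K V] [FiniteDimensional K V]
    (ρ : S →ₙ* Module.End K V)
    (m : ℕ) (hm : HasMultiplicity ρ (starRep p φ) m) :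
    IsIrred (starRep p φ) ∧
    (m : K) * (Module.finrank K (Representation.IntertwiningMap φ φ) : K) =
      ∑ f : Idem S with f ≤ e,
        pairing φ.character (fun g : MaxSubgroup e => character ρ (f.val * g.val)) *
          IncidenceAlgebra.mu K f e := by
  classical
  refine ⟨isIrred_starRep p φ hφ, ?_⟩
  have hW := nontrivial_of_isIrreducible φ
  obtain ⟨c, h0, h1, rfl⟩ := hm
  change _ = moebiusSum φ (character ρ)
  -- The Möbius sum is additive in the character, so each composition factor contributes separately:
  -- `d` if it is isomorphic to `φ*`, else `0`.
  rw [← moduleCharacter_asModule, funext (moduleCharacter_eq_sum c h0 h1), moebiusSum_sum]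
  have hterm : ∀ i : Fin c.length, moebiusSum φ
      (moduleCharacter K (c i.succ ⧸ (c i.castSucc).submoduleOf (c i.succ))) =
      if Nonempty ((c i.succ ⧸ (c i.castSucc).submoduleOf (c i.succ))
        ≃ₗ[MonoidAlgebra K (WithOne S)] (toRep (starRep p φ)).asModule) then
        (Module.finrank K (φ.IntertwiningMap φ) : K) else 0 := by
    intro i
    have : IsSimpleModule (MonoidAlgebra K (WithOne S))
        (c i.succ ⧸ (c i.castSucc).submoduleOf (c i.succ)) :=
      (covBy_iff_quot_is_simple (c.step i).le).1 (c.step i)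
    have := finiteDimensional_submodule (K := K) (c i.succ)
    have := finiteDimensional_quotient (K := K) ((c i.castSucc).submoduleOf (c i.succ))
    exact moebiusSum_of_isSimpleModule p φ
  rw [Finset.sum_congr rfl fun i _ => hterm i, ← Finset.sum_filter, Finset.sum_const, nsmul_eq_mul,
    Nat.card_eq_fintype_card, Fintype.card_subtype]
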